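/- \textbf{Programs.} Consider the function-free core of the discrete probabilistic language Dice: expressions are built from variables, Boolean constants, pairs and projections, $\mathtt{let}\ x=e_1\ \mathtt{in}\ e_2$, $\mathtt{if}\ g\ \mathtt{then}\ e_1\ \mathtt{else}\ e_2$, $\mathtt{flip}_i\,\theta$ (a coin with identifier $i$ that is true with probability $\theta\in[0,1]$) and $\mathtt{observe}\ e$. A program is a closed, well-typed expression in which distinct flips have distinct identifiers. For an assignment $\omega$ of truth values to flips, the run of $P$ under $\omega$ evaluates $P$ from left to right, flip $i$ coming up $\omega(i)$ (an observation returns true and does not stop the run). Write $a\prec_P b$ if in some run of $P$ flips $a$ and $b$ are both executed, $a$ before $b$. \textbf{Compiled BDD.} $P$ compiles to a tuple of Boolean formulas over its flips, which give the Boolean components of the returned value, together with one accepting formula, which says that all executed observations succeed. A variable order for $P$ is a linear order $o$ of the flips of $P$ that is consistent with program order, i.e. $a\prec_P b$ implies that $a$ is before $b$ in $o$. Let $|P|_o$ be the number of nodes (decision nodes and terminals) of the shared multi-rooted reduced ordered BDD of these formulas for the order $o$. \textbf{Hoisting.} To hoist flips $i$ and $j$ with the same parameter $\theta$ into a flip $k$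 means to choose a subexpression $e$ that contains both and to replace it by $\mathtt{let}\ t=\mathtt{flip}_k\,\theta\ \mathtt{in}\ e'$, where $t$ is a fresh program variable and $e'$ is $e$ with both flips replaced by $t$. Let $\mathrm{hoist}(P,i,j)$ be any program obtained from $P$ in this way, possibly with additional hoistings of single flips (each of which keeps its identifier and only moves that flip earlier) performed before or afterwards; the identifier $k$ is not that of a flip of $P$ other than $i,j$. Let $\varphi(i)=\varphi(j)=k$ and $\varphi(a)=a$ for all other flips $a$. \textbf{Theorem.} Let $P$ be a program, let $i$ and $j$ be flips in $P$, let $Q=\mathrm{hoist}(P,i,j)$, and let $o$ and $o'$ be variable orders for $P$ and $Q$. Suppose that hoisting preserves the program variable order: whenever $a\prec_P b$, either $\varphi(a)=\varphi(b)$ or $\varphi(a)$ is before $\varphi(b)$ in $o'$. Then $$|Q|_{o'}\le |P|_o .$$ -/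

import Mathlib

namespace Dice

/-! ### Programs

The function-free core of the probabilistic language Dice. Program variables and flip identifiers
are natural numbers. The Boolean connectives are the usual abbreviations:
`a && b` is `if a then b else false`, and `!a` is `if a then false else true`. -/

/-- Types: Booleans and pairs. -/
inductive Ty where
  | bool : Ty
  | prod : Ty → Ty → Ty

/-- Expressions. `flip i θ` is the flip with identifier `i`, which is true with probability `θ`. -/
inductive Expr where
  | var : ℕ → Expr
  | const : Bool → Expr
  | pair : Expr → Expr → Expr
  | fst : Expr → Expr
  | snd : Expr → Expr
  | letE : ℕ → Expr → Expr → Expr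
  | flip : ℕ → unitInterval → Expr
  | ite : Expr → Expr → Expr → Expr
  | observe : Expr → Expr

/-- The typing judgement `Γ ⊢ e : τ`. -/
inductive HasType : (ℕ → Option Ty) → Expr → Ty → Prop where
  | var {Γ : ℕ → Option Ty} {x : ℕ} {τ : Ty} (h : Γ x = some τ) : HasType Γ (.var x) τ
  | const {Γ : ℕ → Option Ty} (b : Bool) : HasType Γ (.const b) .bool
  | pair {Γ : ℕ → Option Ty} {e₁ e₂ : Expr} {τ₁ τ₂ : Ty}
      (h₁ : HasType Γ e₁ τ₁) (h₂ : HasType Γ e₂ τ₂) : HasType Γ (.pair e₁ e₂) (.prod τ₁ τ₂)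
  | fst {Γ : ℕ → Option Ty} {e : Expr} {τ₁ τ₂ : Ty}
      (h : HasType Γ e (.prod τ₁ τ₂)) : HasType Γ (.fst e) τ₁
  | snd {Γ : ℕ → Option Ty} {e : Expr} {τ₁ τ₂ : Ty}
      (h : HasType Γ e (.prod τ₁ τ₂)) : HasType Γ (.snd e) τ₂
  | letE {Γ : ℕ → Option Ty} {x : ℕ} {e₁ e₂ : Expr} {τ₁ τ₂ : Ty}
      (h₁ : HasType Γ e₁ τ₁) (h₂ : HasType (Function.update Γ x (some τ₁)) e₂ τ₂) :
      HasType Γ (.letE x e₁ e₂) τ₂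
  | flip {Γ : ℕ → Option Ty} (i : ℕ) (θ : unitInterval) : HasType Γ (.flip i θ) .bool
  | ite {Γ : ℕ → Option Ty} {g e₁ e₂ : Expr} {τ : Ty}
      (hg : HasType Γ g .bool) (h₁ : HasType Γ e₁ τ) (h₂ : HasType Γ e₂ τ) :
      HasType Γ (.ite g e₁ e₂) τ
  | observe {Γ : ℕ → Option Ty} {e : Expr} (h : HasType Γ e .bool) : HasType Γ (.observe e) .bool

/-- The occurrences of flips in an expression (identifier and parameter), in textual order. -/
def Expr.occ : Expr → List (ℕ × unitInterval)
  | .var _ => []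
  | .const _ => []
  | .pair e₁ e₂ => e₁.occ ++ e₂.occ
  | .fst e => e.occ
  | .snd e => e.occ
  | .letE _ e₁ e₂ => e₁.occ ++ e₂.occ
  | .flip i θ => [(i, θ)]
  | .ite g e₁ e₂ => g.occ ++ (e₁.occ ++ e₂.occ)
  | .observe e => e.occ

/-- The identifiers of the flips of an expression, in textual order. -/
def Expr.flips (e : Expr) : List ℕ := e.occ.map Prod.fst

/-- The program variables that occur, free or bound, in an expression. -/
def Expr.vars : Expr → List ℕ
  | .var x => [x]
  | .const _ => []
  | .pair e₁ e₂ => e₁.vars ++ e₂.vars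
  | .fst e => e.vars
  | .snd e => e.vars
  | .letE x e₁ e₂ => x :: (e₁.vars ++ e₂.vars)
  | .flip _ _ => []
  | .ite g e₁ e₂ => g.vars ++ (e₁.vars ++ e₂.vars)
  | .observe e => e.vars

/-- A program: a closed, well-typed expression whose flips carry pairwise distinct identifiers. -/
def IsProgram (P : Expr) : Prop :=
  (∃ τ : Ty, HasType (fun _ => none) P τ) ∧ P.flips.Nodup

/-! ### Values and runs -/

/-- Tuples with entries in `α`: `Val Bool` are the values of the language, and tuples of Boolean
formulas are their symbolic counterparts. -/
inductive Val (α : Type) where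
  | leaf : α → Val α
  | pair : Val α → Val α → Val α

namespace Val

variable {α : Type}

/-- The first component (on a pair, the only case that arises in a well-typed program). -/
def fst : Val α → Val α
  | .pair v _ => v
  | .leaf a => .leaf a

/-- The second component (on a pair, the only case that arises in a well-typed program). -/
def snd : Val α → Val α
  | .pair _ w => w
  | .leaf a => .leaf a

/-- The content of a leaf (the only case in which it is used in a well-typed program). -/
def get (d : α) : Val α → α
  | .leaf a => a
  | .pair _ _ => d

/-- The entries of a tuple. -/
def leaves : Val α → List α
  | .leaf a => [a]
  | .pair v w => v.leaves ++ w.leaves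

/-- Combines two tuples of the same shape entry by entry. -/
def zipWith (d : α) (f : α → α → α) : Val α → Val α → Val α
  | .leaf a, .leaf b => .leaf (f a b)
  | .pair v w, .pair v' w' => .pair (zipWith d f v v') (zipWith d f w w')
  | _, _ => .leaf d

end Val

/-- The run of an expression in the environment `ρ` when every flip `i` that is executed comes up
`ω i`: the returned value, and the list of the executed flips in the order of execution. -/
def Expr.run (ω : ℕ → Bool) : (ℕ → Val Bool) → Expr → Val Bool × List ℕ
  | ρ, .var x => (ρ x, [])
  | _, .const b => (.leaf b, [])
  | ρ, .pair e₁ e₂ =>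
      (.pair (e₁.run ω ρ).1 (e₂.run ω ρ).1, (e₁.run ω ρ).2 ++ (e₂.run ω ρ).2)
  | ρ, .fst e => ((e.run ω ρ).1.fst, (e.run ω ρ).2)
  | ρ, .snd e => ((e.run ω ρ).1.snd, (e.run ω ρ).2)
  | ρ, .letE x e₁ e₂ =>
      let r₁ := e₁.run ω ρ
      let r₂ := e₂.run ω (Function.update ρ x r₁.1)
      (r₂.1, r₁.2 ++ r₂.2)
  | _, .flip i _ => (.leaf (ω i), [i])
  | ρ, .ite g e₁ e₂ =>
      let r := g.run ω ρ
      let s := if r.1.get false = true then e₁.run ω ρ else e₂.run ω ρ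
      (s.1, r.2 ++ s.2)
  | ρ, .observe e => (.leaf true, (e.run ω ρ).2)

/-- The flips executed by a closed program under the outcomes `ω`, in the order of execution. -/
def trace (P : Expr) (ω : ℕ → Bool) : List ℕ := (P.run ω fun _ => .leaf false).2

/-- Program order: some run of the program executes both flips `a` and `b`, and `a` before `b`. -/
def Precedes (P : Expr) (a b : ℕ) : Prop := ∃ ω : ℕ → Bool, [a, b].Sublist (trace P ω)

/-! ### Compilation -/

/-- Boolean formulas over the flips. -/
inductive Formula where
  | const : Bool → Formula
  | var : ℕ → Formula
  | and : Formula → Formula → Formula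
  | ite : Formula → Formula → Formula → Formula

/-- The truth value of a formula under an assignment. -/
def Formula.eval (ω : ℕ → Bool) : Formula → Bool
  | .const b => b
  | .var i => ω i
  | .and f g => f.eval ω && g.eval ω
  | .ite f g h => if f.eval ω = true then g.eval ω else h.eval ω

/-- Compilation of an expression to Boolean formulas: a tuple of formulas for the returned value,
and the accepting formula, which states that all executed observations succeed. -/
def Expr.compile : (ℕ → Val Formula) → Expr → Val Formula × Formula
  | ρ, .var x => (ρ x, .const true)
  | _, .const b => (.leaf (.const b), .const true)
  | ρ, .pair e₁ e₂ =>
      (.pair (e₁.compile ρ).1 (e₂.compile ρ).1, .and (e₁.compile ρ).2 (e₂.compile ρ).2)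
  | ρ, .fst e => ((e.compile ρ).1.fst, (e.compile ρ).2)
  | ρ, .snd e => ((e.compile ρ).1.snd, (e.compile ρ).2)
  | ρ, .letE x e₁ e₂ =>
      let r₁ := e₁.compile ρ
      let r₂ := e₂.compile (Function.update ρ x r₁.1)
      (r₂.1, .and r₁.2 r₂.2)
  | _, .flip i _ => (.leaf (.var i), .const true)
  | ρ, .ite g e₁ e₂ =>
      let r := g.compile ρ
      let c := r.1.get (.const false)
      let s₁ := e₁.compile ρ
      let s₂ := e₂.compile ρ
      (Val.zipWith (.const false) (fun f₁ f₂ => .ite c f₁ f₂) s₁.1 s₂.1,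
        .and r.2 (.ite c s₁.2 s₂.2))
  | ρ, .observe e =>
      let r := e.compile ρ
      (.leaf (.const true), .and r.2 (r.1.get (.const false)))

/-- Binary decision diagrams. A diagram is represented by its unfolding; as nodes are shared
whenever they root the same diagram, a node of a diagram is the same as a subdiagram. -/
inductive BDD where
  | leaf : Bool → BDD
  | node : ℕ → BDD → BDD → BDD
  deriving DecidableEq

/-- Creates a decision node, unless the test is redundant. -/
def BDD.mk (v : ℕ) (lo hi : BDD) : BDD := if lo = hi then lo else .node v lo hi

/-- The set of nodes of a diagram, decision nodes as well as terminals. -/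
def BDD.nodes : BDD → Finset BDD
  | .leaf b => {.leaf b}
  | .node v lo hi => insert (.node v lo hi) (lo.nodes ∪ hi.nodes)

/-- The reduced ordered binary decision diagram, for a given variable order, of a Boolean function
that depends on the listed variables only. -/
def robdd : List ℕ → ((ℕ → Bool) → Bool) → BDD
  | [], f => .leaf (f fun _ => false)
  | v :: vs, f =>
      BDD.mk v (robdd vs fun ω => f (Function.update ω v false))
        (robdd vs fun ω => f (Function.update ω v true))

/-- The formulas to which a closed program compiles: those of the returned tuple, and the accepting
formula. -/
def compiledFormulas (P : Expr) : List Formula :=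
  let r := P.compile fun _ => .leaf (.const false)
  r.1.leaves ++ [r.2]

/-- The roots of the multi-rooted BDD compiled from a program with the variable order `o`. -/
def bddRoots (o : List ℕ) (P : Expr) : Finset BDD :=
  ((compiledFormulas P).map fun F => robdd o fun ω => F.eval ω).toFinset

/-- The number of nodes of the BDD compiled from a program with the variable order `o`; nodes are
shared between the roots. -/
def bddSize (o : List ℕ) (P : Expr) : ℕ := ((bddRoots o P).biUnion BDD.nodes).card

/-- `o` is a variable order for the BDD of `P`: it lists every flip of `P` exactly once,
consistently with program order. -/
def IsVarOrder (P : Expr) (o : List ℕ) : Prop :=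
  o.Perm P.flips ∧ ∀ a b : ℕ, Precedes P a b → o.idxOf a < o.idxOf b

/-! ### Hoisting -/

/-- Replaces the flips `i` and `j` by references to the program variable `t`. -/
def Expr.replaceFlips (i j t : ℕ) : Expr → Expr
  | .var x => .var x
  | .const b => .const b
  | .pair e₁ e₂ => .pair (e₁.replaceFlips i j t) (e₂.replaceFlips i j t)
  | .fst e => .fst (e.replaceFlips i j t)
  | .snd e => .snd (e.replaceFlips i j t)
  | .letE x e₁ e₂ => .letE x (e₁.replaceFlips i j t) (e₂.replaceFlips i j t)
  | .flip m θ => if m = i ∨ m = j then .var t else .flip m θ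
  | .ite g e₁ e₂ =>
      .ite (g.replaceFlips i j t) (e₁.replaceFlips i j t) (e₂.replaceFlips i j t)
  | .observe e => .observe (e.replaceFlips i j t)

/-- `HoistStep i j k P Q`: some subexpression `e` of `P` that contains the flips `i` and `j`, with
the same parameter `θ`, is replaced by `let t = flip k θ in e'` with a fresh variable `t`, where
`e'` is `e` with both flips replaced by `t`. All insertion points are allowed. -/
inductive HoistStep (i j k : ℕ) : Expr → Expr → Prop where
  | here (t : ℕ) (θ : unitInterval) (e : Expr) (ht : t ∉ e.vars)
      (hi : (i, θ) ∈ e.occ) (hj : (j, θ) ∈ e.occ) :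
      HoistStep i j k e (.letE t (.flip k θ) (e.replaceFlips i j t))
  | pairL {e₁ e₁' : Expr} (e₂ : Expr) (h : HoistStep i j k e₁ e₁') :
      HoistStep i j k (.pair e₁ e₂) (.pair e₁' e₂)
  | pairR (e₁ : Expr) {e₂ e₂' : Expr} (h : HoistStep i j k e₂ e₂') :
      HoistStep i j k (.pair e₁ e₂) (.pair e₁ e₂')
  | fst {e e' : Expr} (h : HoistStep i j k e e') : HoistStep i j k (.fst e) (.fst e')
  | snd {e e' : Expr} (h : HoistStep i j k e e') : HoistStep i j k (.snd e) (.snd e')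
  | letL (x : ℕ) {e₁ e₁' : Expr} (e₂ : Expr) (h : HoistStep i j k e₁ e₁') :
      HoistStep i j k (.letE x e₁ e₂) (.letE x e₁' e₂)
  | letR (x : ℕ) (e₁ : Expr) {e₂ e₂' : Expr} (h : HoistStep i j k e₂ e₂') :
      HoistStep i j k (.letE x e₁ e₂) (.letE x e₁ e₂')
  | guard {g g' : Expr} (e₁ e₂ : Expr) (h : HoistStep i j k g g') :
      HoistStep i j k (.ite g e₁ e₂) (.ite g' e₁ e₂)
  | thenB (g : Expr) {e₁ e₁' : Expr} (e₂ : Expr) (h : HoistStep i j k e₁ e₁') :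
      HoistStep i j k (.ite g e₁ e₂) (.ite g e₁' e₂)
  | elseB (g e₁ : Expr) {e₂ e₂' : Expr} (h : HoistStep i j k e₂ e₂') :
      HoistStep i j k (.ite g e₁ e₂) (.ite g e₁ e₂')
  | observe {e e' : Expr} (h : HoistStep i j k e e') :
      HoistStep i j k (.observe e) (.observe e')

/-- An additional hoisting of a single flip, which only moves that flip earlier. -/
def MoveStep (P Q : Expr) : Prop := ∃ m : ℕ, HoistStep m m m P Q

/-- `Q` results from `P` by hoisting the flips `i` and `j` into a single new flip, with the
identifier `k`, and by any number (possibly zero) of additional hoistings of single flips. -/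
def IsHoist (i j k : ℕ) (P Q : Expr) : Prop :=
  (∀ m ∈ P.flips, m = k → m = i ∨ m = j) ∧
  ∃ R S : Expr, Relation.ReflTransGen MoveStep P R ∧ HoistStep i j k R S ∧
    Relation.ReflTransGen MoveStep S Q

/-- The flip of the hoisted program that stands for the flip `a` of the original program. -/
def relabel (i j k a : ℕ) : ℕ := if a = i ∨ a = j then k else a

/-- The hoisting of the flips `i` and `j` of `P` into `k` preserves the program variable order, when
the hoisted program is compiled with the variable order `o'`: if a flip `a` is executed before a
flip `b` in some run of `P`, then the flips standing for them are the same one, or occur in the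
same order in `o'`. -/
def PreservesOrder (i j k : ℕ) (P : Expr) (o' : List ℕ) : Prop :=
  ∀ a b : ℕ, Precedes P a b → relabel i j k a = relabel i j k b ∨
    o'.idxOf (relabel i j k a) < o'.idxOf (relabel i j k b)

end Dice

/-! The functions compiled from `Q` are those compiled from `P` with `i` and `j` both read as `k`
(`IsHoist.sem_eq`, `IsHoist.exists_formula`). It is therefore enough to find a map on diagrams that
performs this identification and whose values on the nodes of `P` include all nodes of `Q`; the size
bound is then the fact that an image is no larger than its source.

The map is `BDD.merge`. It works from the bottom up: it renames `i` and `j` to `k`, drops a second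
test of `k` directly below a first one, and collapses tests that have become redundant. Its value on
a diagram depends on that diagram alone, so sharing between the roots is respected, and no step
creates a node that is not the merge of an old node (`BDD.nodes_merge_subset`).

It remains to see that merging the reduced diagram of `P` gives the reduced diagram of `Q` for `o'`
(`robdd_hoist`). By canonicity (`robdd_eq`) this comes down to the merged diagram being ordered by
`o'`. Here consistency of `o` with `o'` would be too much to ask, since the two orders may disagree
on flips that never occur in a common run. The diagram of `P`, however, satisfies more than `o`: it
is the reduction of the execution tree, whose paths are runs, so a flip tested above another one
precedes it in some run (`exists_diagram`). Only such pairs matter, and for them `PreservesOrder`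
says that after relabelling they coincide or are in the order `o'`. If they coincide, no third
variable can remain between the two tests of `k`, so removing a test at the root of a child is
sufficient (`BDD.Ordered.merge`). -/

namespace Dice

/-! ### Decision trees -/

/-- Decision trees over the flips, with results in `α`. -/
inductive DTree (α : Type) where
  | ret : α → DTree α
  | node : ℕ → DTree α → DTree α → DTree α

namespace DTree

variable {α β : Type}

/-- Sequential composition. -/
def bind : DTree α → (α → DTree β) → DTree β
  | .ret a, k => k a
  | .node v l h, k => .node v (l.bind k) (h.bind k)

/-- Applies a function to the results. -/
def map (f : α → β) : DTree α → DTree β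
  | .ret a => .ret (f a)
  | .node v l h => .node v (l.map f) (h.map f)

/-- The result reached under an assignment. -/
def eval (ω : ℕ → Bool) : DTree α → α
  | .ret a => a
  | .node v l h => if ω v = true then h.eval ω else l.eval ω

/-- The variables tested under an assignment, in the order of the tests. -/
def path (ω : ℕ → Bool) : DTree α → List ℕ
  | .ret _ => []
  | .node v l h => v :: (if ω v = true then h.path ω else l.path ω)

/-- The variables of a decision tree. -/
def vars : DTree α → List ℕ
  | .ret _ => []
  | .node v l h => v :: (l.vars ++ h.vars)

/-- Every variable is related by `R` to all variables strictly below it. -/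
def Ordered (R : ℕ → ℕ → Prop) : DTree α → Prop
  | .ret _ => True
  | .node v l h =>
      (∀ w ∈ l.vars, R v w) ∧ (∀ w ∈ h.vars, R v w) ∧ l.Ordered R ∧ h.Ordered R

theorem eval_bind (ω : ℕ → Bool) (t : DTree α) (k : α → DTree β) :
    (t.bind k).eval ω = (k (t.eval ω)).eval ω := by
  induction t with
  | ret a => rfl
  | node v l h hl hh => simp only [bind, eval, hl, hh]; split <;> rfl

theorem path_bind (ω : ℕ → Bool) (t : DTree α) (k : α → DTree β) :
    (t.bind k).path ω = t.path ω ++ (k (t.eval ω)).path ω := by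
  induction t with
  | ret a => rfl
  | node v l h hl hh => simp only [bind, eval, path, hl, hh]; split <;> simp

theorem mem_vars_bind {t : DTree α} {k : α → DTree β} {w : ℕ} (hw : w ∈ (t.bind k).vars) :
    w ∈ t.vars ∨ ∃ a, w ∈ (k a).vars := by
  induction t with
  | ret a => exact .inr ⟨a, hw⟩
  | node v l h hl hh =>
    simp only [bind, vars, List.mem_cons, List.mem_append] at hw ⊢
    grind

theorem Ordered.bind {R : ℕ → ℕ → Prop} {t : DTree α} {k : α → DTree β} (ht : t.Ordered R)
    (hk : ∀ a, (k a).Ordered R) (htk : ∀ a, ∀ v ∈ t.vars, ∀ w ∈ (k a).vars, R v w) :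
    (t.bind k).Ordered R := by
  induction t with
  | ret a => exact hk a
  | node v l h hl hh =>
    simp only [vars, List.mem_cons, List.mem_append] at htk
    obtain ⟨h₁, h₂, h₃, h₄⟩ := ht
    refine ⟨fun w hw => ?_, fun w hw => ?_, hl h₃ ?_, hh h₄ ?_⟩
    · rcases mem_vars_bind hw with hw | ⟨a, hw⟩
      exacts [h₁ w hw, htk a v (.inl rfl) w hw]
    · rcases mem_vars_bind hw with hw | ⟨a, hw⟩
      exacts [h₂ w hw, htk a v (.inl rfl) w hw]
    · exact fun a v hv => htk a v (.inr (.inl hv))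
    · exact fun a v hv => htk a v (.inr (.inr hv))

theorem eval_map (ω : ℕ → Bool) (f : α → β) (t : DTree α) :
    (t.map f).eval ω = f (t.eval ω) := by
  induction t with
  | ret a => rfl
  | node v l h hl hh => simp only [map, eval, hl, hh]; split <;> rfl

theorem path_map (ω : ℕ → Bool) (f : α → β) (t : DTree α) : (t.map f).path ω = t.path ω := by
  induction t with
  | ret a => rfl
  | node v l h hl hh => simp only [map, path, hl, hh]

theorem vars_map (f : α → β) (t : DTree α) : (t.map f).vars = t.vars := by
  induction t with
  | ret a => rfl
  | node v l h hl hh => simp only [map, vars, hl, hh]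

theorem Ordered.map {R : ℕ → ℕ → Prop} (f : α → β) {t : DTree α} (ht : t.Ordered R) :
    (t.map f).Ordered R := by
  induction t with
  | ret a => trivial
  | node v l h hl hh =>
    simp only [DTree.map, Ordered, vars_map] at ht ⊢
    exact ⟨ht.1, ht.2.1, hl ht.2.2.1, hh ht.2.2.2⟩

theorem path_congr {ω ω' : ℕ → Bool} {t : DTree α} (h : ∀ v ∈ t.vars, ω v = ω' v) :
    t.path ω = t.path ω' := by
  induction t with
  | ret a => rfl
  | node v l r hl hr =>
    simp only [vars, List.mem_cons, List.mem_append] at h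
    simp only [path, h v (.inl rfl), hl fun w hw => h w (.inr (.inl hw)),
      hr fun w hw => h w (.inr (.inr hw))]

theorem path_update {t : DTree α} {v : ℕ} (hv : v ∉ t.vars) (ω : ℕ → Bool) (b : Bool) :
    t.path (Function.update ω v b) = t.path ω :=
  path_congr fun w hw => Function.update_of_ne (fun h : w = v => hv (h ▸ hw)) _ _

/-- In a decision tree without repeated tests every variable is tested under some assignment. -/
theorem exists_mem_path {t : DTree α} (ht : t.Ordered (· ≠ ·)) {w : ℕ} (hw : w ∈ t.vars) :
    ∃ ω, w ∈ t.path ω := by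
  induction t with
  | ret a => cases hw
  | node v l h hl hh =>
    obtain ⟨h₁, h₂, h₃, h₄⟩ := ht
    simp only [vars, List.mem_cons, List.mem_append] at hw
    rcases hw with rfl | hw | hw
    · exact ⟨fun _ => false, by simp [path]⟩
    · obtain ⟨ω, hω⟩ := hl h₃ hw
      refine ⟨Function.update ω v false, ?_⟩
      simp [path, path_update (fun hv => h₁ v hv rfl), hω]
    · obtain ⟨ω, hω⟩ := hh h₄ hw
      refine ⟨Function.update ω v true, ?_⟩
      simp [path, path_update (fun hv => h₂ v hv rfl), hω]

/-- Without repeated tests, the outcome at the root can be prescribed without disturbing the paths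
below it. Hence any two variables of which one lies below the other are tested along the path of one
assignment. This turns the order of runs into an order of the whole tree. -/
theorem Ordered.of_path {R : ℕ → ℕ → Prop} {t : DTree α} (ht : t.Ordered (· ≠ ·))
    (hR : ∀ ω a b, [a, b].Sublist (t.path ω) → R a b) : t.Ordered R := by
  induction t with
  | ret a => trivial
  | node v l h hl hh =>
    obtain ⟨h₁, h₂, h₃, h₄⟩ := ht
    have el : ∀ ω, (node v l h).path (Function.update ω v false) = v :: l.path ω := fun ω => by
      simp [path, path_update (fun hv => h₁ v hv rfl)]
    have eh : ∀ ω, (node v l h).path (Function.update ω v true) = v :: h.path ω := fun ω => by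
      simp [path, path_update (fun hv => h₂ v hv rfl)]
    refine ⟨fun w hw => ?_, fun w hw => ?_, hl h₃ fun ω a b hab => ?_, hh h₄ fun ω a b hab => ?_⟩
    · obtain ⟨ω, hω⟩ := exists_mem_path h₃ hw
      exact hR _ v w (el ω ▸ (List.singleton_sublist.2 hω).cons_cons v)
    · obtain ⟨ω, hω⟩ := exists_mem_path h₄ hw
      exact hR _ v w (eh ω ▸ (List.singleton_sublist.2 hω).cons_cons v)
    · exact hR _ a b (el ω ▸ hab.cons v)
    · exact hR _ a b (eh ω ▸ hab.cons v)

end DTree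

/-! ### Binary decision diagrams -/

namespace BDD

/-- The truth value of a diagram under an assignment. -/
def eval (ω : ℕ → Bool) : BDD → Bool
  | .leaf b => b
  | .node v l h => if ω v = true then h.eval ω else l.eval ω

/-- The variables of a diagram. -/
def vars : BDD → List ℕ
  | .leaf _ => []
  | .node v l h => v :: (l.vars ++ h.vars)

/-- The diagram has no redundant test, and every variable is related by `R` to all variables
strictly below it. -/
def Ordered (R : ℕ → ℕ → Prop) : BDD → Prop
  | .leaf _ => True
  | .node v l h =>
      l ≠ h ∧ (∀ w ∈ l.vars, R v w) ∧ (∀ w ∈ h.vars, R v w) ∧ l.Ordered R ∧ h.Ordered R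

theorem eval_mk (ω : ℕ → Bool) (v : ℕ) (l h : BDD) :
    (mk v l h).eval ω = if ω v = true then h.eval ω else l.eval ω := by
  unfold mk
  split_ifs with e <;> simp_all [eval]

theorem mem_vars_mk {v w : ℕ} {l h : BDD} (hw : w ∈ (mk v l h).vars) :
    w = v ∨ w ∈ l.vars ∨ w ∈ h.vars := by
  unfold mk at hw
  split_ifs at hw with e
  · exact .inr (.inl hw)
  · simpa [vars] using hw

theorem Ordered.mk {R : ℕ → ℕ → Prop} {v : ℕ} {l h : BDD} (hl : ∀ w ∈ l.vars, R v w)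
    (hh : ∀ w ∈ h.vars, R v w) (hl' : l.Ordered R) (hh' : h.Ordered R) :
    (BDD.mk v l h).Ordered R := by
  unfold BDD.mk
  split_ifs with e
  exacts [hl', ⟨e, hl, hh, hl', hh'⟩]

theorem nodes_mk_subset (v : ℕ) (l h : BDD) :
    (mk v l h).nodes ⊆ insert (mk v l h) (l.nodes ∪ h.nodes) := by
  by_cases e : l = h
  · simp only [mk, if_pos e]
    exact fun x hx => by simp [hx]
  · simp only [mk, if_neg e, nodes, Finset.Subset.refl]

theorem Ordered.mono {R S : ℕ → ℕ → Prop} {D : BDD} (hD : D.Ordered R)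
    (h : ∀ a ∈ D.vars, ∀ b ∈ D.vars, R a b → S a b) : D.Ordered S := by
  induction D with
  | leaf b => trivial
  | node v l r hl hr =>
    simp only [vars, List.mem_cons, List.mem_append] at h
    obtain ⟨h₀, h₁, h₂, h₃, h₄⟩ := hD
    exact ⟨h₀, fun w hw => h v (.inl rfl) w (.inr (.inl hw)) (h₁ w hw),
      fun w hw => h v (.inl rfl) w (.inr (.inr hw)) (h₂ w hw),
      hl h₃ fun a ha b hb => h a (.inr (.inl ha)) b (.inr (.inl hb)),
      hr h₄ fun a ha b hb => h a (.inr (.inr ha)) b (.inr (.inr hb))⟩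

theorem eval_congr {ω ω' : ℕ → Bool} {D : BDD} (h : ∀ v ∈ D.vars, ω v = ω' v) :
    D.eval ω = D.eval ω' := by
  induction D with
  | leaf b => rfl
  | node v l r hl hr =>
    simp only [vars, List.mem_cons, List.mem_append] at h
    simp only [eval, h v (.inl rfl), hl fun w hw => h w (.inr (.inl hw)),
      hr fun w hw => h w (.inr (.inr hw))]

theorem eval_update {D : BDD} {v : ℕ} (hv : v ∉ D.vars) (ω : ℕ → Bool) (b : Bool) :
    D.eval (Function.update ω v b) = D.eval ω :=
  eval_congr fun w hw => Function.update_of_ne (fun h : w = v => hv (h ▸ hw)) _ _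

/-! ### Merging two variables of a diagram -/

/-- The diagram below the root if the root tests `k` and `k` has the value `b`. -/
def restrict (k : ℕ) (b : Bool) : BDD → BDD
  | .leaf c => .leaf c
  | .node v l h => if v = k then (if b = true then h else l) else .node v l h

theorem eval_restrict {k : ℕ} {b : Bool} {ω : ℕ → Bool} (hb : ω k = b) (D : BDD) :
    (D.restrict k b).eval ω = D.eval ω := by
  cases D with
  | leaf c => rfl
  | node v l h =>
    by_cases e : v = k
    · subst e
      simp only [restrict, eval, hb, if_true]
      split <;> rfl
    · simp [restrict, e]

theorem vars_restrict_subset (k : ℕ) (b : Bool) (D : BDD) : (D.restrict k b).vars ⊆ D.vars := by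
  cases D with
  | leaf c => exact fun x hx => hx
  | node v l h =>
    intro x hx
    simp only [restrict] at hx
    split_ifs at hx <;> simp [vars] at hx ⊢ <;> tauto

theorem nodes_restrict_subset (k : ℕ) (b : Bool) (D : BDD) :
    (D.restrict k b).nodes ⊆ D.nodes := by
  cases D with
  | leaf c => exact fun x hx => hx
  | node v l h =>
    intro x hx
    simp only [restrict] at hx
    split_ifs at hx <;> simp [nodes] at hx ⊢ <;> tauto

theorem Ordered.restrict {R : ℕ → ℕ → Prop} {D : BDD} (hD : D.Ordered R) (k : ℕ) (b : Bool) :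
    (D.restrict k b).Ordered R := by
  cases D with
  | leaf c => trivial
  | node v l h =>
    simp only [BDD.restrict]
    split_ifs
    exacts [hD.2.2.2.2, hD.2.2.2.1, hD]

/-- If `k` occurs in `D` it can only be at the root, because a different root would have to come
strictly after `k` and yet be above it. Restriction removes that root, and what is left lies
strictly after `k`. -/
theorem rel_of_mem_vars_restrict {r : ℕ → ℕ} {D : BDD} (hD : D.Ordered fun a b => r a < r b)
    {k : ℕ} (hk : ∀ w ∈ D.vars, w = k ∨ r k < r w) {b : Bool} {w : ℕ}
    (hw : w ∈ (D.restrict k b).vars) : r k < r w := by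
  cases D with
  | leaf c => cases hw
  | node v l h =>
    obtain ⟨-, h₁, h₂, -, -⟩ := hD
    by_cases e : v = k
    · subst e
      cases b <;> simp only [BDD.restrict, if_true, Bool.false_eq_true, if_false] at hw
      exacts [h₁ w hw, h₂ w hw]
    · simp only [BDD.restrict, if_neg e, vars, List.mem_cons, List.mem_append] at hw hk
      have hv : r k < r v := (hk v (.inl rfl)).resolve_left e
      rcases hw with rfl | hw | hw
      exacts [hv, hv.trans (h₁ w hw), hv.trans (h₂ w hw)]

/-- Merges the variables `i` and `j` into the variable `k`. -/
def merge (i j k : ℕ) : BDD → BDD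
  | .leaf b => .leaf b
  | .node v l h =>
      if v = i ∨ v = j then mk k ((l.merge i j k).restrict k false) ((h.merge i j k).restrict k true)
      else mk v (l.merge i j k) (h.merge i j k)

/-- Each restriction sits in the branch where `k` has the value restricted to, so it does not change
the truth value. -/
theorem eval_merge (i j k : ℕ) (ω : ℕ → Bool) (D : BDD) :
    (D.merge i j k).eval ω = D.eval fun a => ω (relabel i j k a) := by
  induction D with
  | leaf b => rfl
  | node v l h hl hh =>
    by_cases e : v = i ∨ v = j
    · simp only [merge, if_pos e, eval_mk, eval, relabel]
      split_ifs with hk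
      · rw [eval_restrict hk, hh]; rfl
      · rw [eval_restrict (by simpa using hk), hl]; rfl
    · simp only [merge, if_neg e, eval_mk, eval, relabel, hl, hh]

/-- This carries the count. Apart from its root, which is the merge of the old root, a merged
diagram has only nodes of the merged children, since `restrict` and `mk` pass to existing
subdiagrams. -/
theorem nodes_merge_subset (i j k : ℕ) (D : BDD) :
    (D.merge i j k).nodes ⊆ D.nodes.image (merge i j k) := by
  induction D with
  | leaf b => simp [merge, nodes]
  | node v l h hl hh =>
    intro x hx
    have key : x = (node v l h).merge i j k ∨ x ∈ (l.merge i j k).nodes ∨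
        x ∈ (h.merge i j k).nodes := by
      by_cases e : v = i ∨ v = j
      · simp only [merge, if_pos e] at hx ⊢
        have := nodes_mk_subset _ _ _ hx
        simp only [Finset.mem_insert, Finset.mem_union] at this
        exact this.imp_right (Or.imp (fun h => nodes_restrict_subset _ _ _ h)
          (fun h => nodes_restrict_subset _ _ _ h))
      · simp only [merge, if_neg e] at hx ⊢
        simpa only [Finset.mem_insert, Finset.mem_union] using nodes_mk_subset _ _ _ hx
    simp only [nodes, Finset.image_insert, Finset.image_union, Finset.mem_insert,
      Finset.mem_union]
    exact key.imp_right (Or.imp (fun h => hl h) (fun h => hh h))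

theorem exists_of_mem_vars_merge {i j k : ℕ} {D : BDD} {w : ℕ} (hw : w ∈ (D.merge i j k).vars) :
    ∃ a ∈ D.vars, relabel i j k a = w := by
  induction D with
  | leaf b => cases hw
  | node v l h hl hh =>
    have key : w = relabel i j k v ∨ w ∈ (l.merge i j k).vars ∨ w ∈ (h.merge i j k).vars := by
      by_cases e : v = i ∨ v = j
      · simp only [merge, if_pos e, relabel] at hw ⊢
        exact (mem_vars_mk hw).imp_right (Or.imp (fun h => vars_restrict_subset _ _ _ h)
          (fun h => vars_restrict_subset _ _ _ h))
      · simp only [merge, if_neg e, relabel] at hw ⊢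
        exact mem_vars_mk hw
    simp only [vars, List.mem_cons, List.mem_append]
    rcases key with rfl | hw | hw
    · exact ⟨v, .inl rfl, rfl⟩
    · obtain ⟨a, ha, e⟩ := hl hw
      exact ⟨a, .inr (.inl ha), e⟩
    · obtain ⟨a, ha, e⟩ := hh hw
      exact ⟨a, .inr (.inr ha), e⟩

/-- The first alternative allows a repeated test of `k` only below a test of `i` or `j`, because
`merge` restricts the children at these tests and nowhere else. Whether the tests of `D` are
redundant plays no role, as `mk` restores reducedness. -/
theorem Ordered.merge {i j k : ℕ} {r : ℕ → ℕ} {D : BDD}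
    (hD : D.Ordered fun a b => ((a = i ∨ a = j) ∧ relabel i j k b = k) ∨
      r (relabel i j k a) < r (relabel i j k b)) :
    (D.merge i j k).Ordered fun a b => r a < r b := by
  induction D with
  | leaf b => trivial
  | node v l h hl hh =>
    obtain ⟨-, h₁, h₂, h₃, h₄⟩ := hD
    have ol := hl h₃
    have oh := hh h₄
    by_cases e : v = i ∨ v = j
    · have ev : relabel i j k v = k := if_pos e
      have aux : ∀ D : BDD, (∀ w ∈ D.vars, ((v = i ∨ v = j) ∧ relabel i j k w = k) ∨
          r (relabel i j k v) < r (relabel i j k w)) →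
          ∀ w ∈ (D.merge i j k).vars, w = k ∨ r k < r w := by
        intro D h w hw
        obtain ⟨a, ha, rfl⟩ := exists_of_mem_vars_merge hw
        rw [ev] at h
        exact (h a ha).imp_left And.right
      simp only [BDD.merge, if_pos e]
      exact .mk (fun w hw => rel_of_mem_vars_restrict ol (aux l h₁) hw)
        (fun w hw => rel_of_mem_vars_restrict oh (aux h h₂) hw) (ol.restrict _ _) (oh.restrict _ _)
    · have ev : relabel i j k v = v := if_neg e
      simp only [BDD.merge, if_neg e]
      refine .mk (fun w hw => ?_) (fun w hw => ?_) ol oh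
      · obtain ⟨a, ha, rfl⟩ := exists_of_mem_vars_merge hw
        exact ev ▸ (h₁ a ha).resolve_left (e ·.1)
      · obtain ⟨a, ha, rfl⟩ := exists_of_mem_vars_merge hw
        exact ev ▸ (h₂ a ha).resolve_left (e ·.1)

end BDD

/-- Canonicity: a reduced diagram ordered by `o` is the one computed by `robdd`. -/
theorem robdd_eq {o : List ℕ} {D : BDD} {f : (ℕ → Bool) → Bool}
    (hD : D.Ordered fun a b => o.idxOf a < o.idxOf b) (hv : ∀ w ∈ D.vars, w ∈ o)
    (hf : ∀ ω, f ω = D.eval ω) : robdd o f = D := by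
  induction o generalizing D f with
  | nil =>
    cases D with
    | leaf b => simp [robdd, hf, BDD.eval]
    | node v l h => exact absurd (hv v (by simp [BDD.vars])) (by simp)
  | cons v vs ih =>
    -- Away from the head `v`, positions in `v :: vs` are those in `vs` plus one, so the order
    -- descends to `vs` and the induction hypothesis applies.
    have shift : ∀ E : BDD, v ∉ E.vars → (∀ w ∈ E.vars, w ∈ v :: vs) →
        (E.Ordered fun a b => (v :: vs).idxOf a < (v :: vs).idxOf b) →
        ∀ g : (ℕ → Bool) → Bool, (∀ ω, g ω = E.eval ω) → robdd vs g = E := by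
      intro E hvE hE ho g hg
      have hne : ∀ a ∈ E.vars, v ≠ a := fun a ha h => hvE (h ▸ ha)
      refine ih (ho.mono fun a ha b hb hab => ?_) (fun w hw => ?_) hg
      · rwa [List.idxOf_cons_ne _ (hne a ha), List.idxOf_cons_ne _ (hne b hb),
          Nat.succ_lt_succ_iff] at hab
      · exact (List.mem_cons.1 (hE w hw)).resolve_left (hne w hw).symm
    by_cases hvD : v ∈ D.vars
    · cases D with
      | leaf b => cases hvD
      | node u l h =>
        obtain ⟨h₀, h₁, h₂, h₃, h₄⟩ := hD
        -- The head has position 0, so no variable can be tested above it: if it occurs, it is at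
        -- the root.
        have hu : u = v := by
          simp only [BDD.vars, List.mem_cons, List.mem_append] at hvD
          rcases hvD with h | h | h
          · exact h.symm
          · simpa using h₁ v h
          · simpa using h₂ v h
        subst hu
        have hl : u ∉ l.vars := fun h => lt_irrefl _ (h₁ u h)
        have hh : u ∉ h.vars := fun h => lt_irrefl _ (h₂ u h)
        have el := shift l hl (fun w hw => hv w (by simp [BDD.vars, hw])) h₃
          (fun ω => f (Function.update ω u false)) fun ω => by
            simp [hf, BDD.eval, BDD.eval_update hl]
        have eh := shift h hh (fun w hw => hv w (by simp [BDD.vars, hw])) h₄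
          (fun ω => f (Function.update ω u true)) fun ω => by
            simp [hf, BDD.eval, BDD.eval_update hh]
        rw [robdd, el, eh]
        exact if_neg h₀
    -- If the head does not occur, both cofactors have the diagram `D`, and `mk` collapses the test.
    · have hb : ∀ b, robdd vs (fun ω => f (Function.update ω v b)) = D := fun b =>
        shift D hvD hv hD _ fun ω => by rw [hf, BDD.eval_update hvD]
      rw [robdd, hb, hb]
      exact if_pos rfl

/-! ### Reduction of decision trees -/

/-- The reduced diagram of a decision tree. -/
def DTree.reduce : DTree Bool → BDD
  | .ret b => .leaf b
  | .node v l h => BDD.mk v l.reduce h.reduce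

theorem DTree.eval_reduce (ω : ℕ → Bool) (t : DTree Bool) : t.reduce.eval ω = t.eval ω := by
  induction t with
  | ret b => rfl
  | node v l h hl hh => simp only [reduce, BDD.eval_mk, eval, hl, hh]

theorem DTree.vars_reduce_subset (t : DTree Bool) : t.reduce.vars ⊆ t.vars := by
  induction t with
  | ret b => exact fun x hx => hx
  | node v l h hl hh =>
    intro x hx
    simp only [vars, List.mem_cons, List.mem_append]
    exact (BDD.mem_vars_mk hx).imp_right (Or.imp (fun h => hl h) (fun h => hh h))

theorem DTree.Ordered.reduce {R : ℕ → ℕ → Prop} {t : DTree Bool} (ht : t.Ordered R) :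
    t.reduce.Ordered R := by
  induction t with
  | ret b => trivial
  | node v l h hl hh =>
    obtain ⟨h₁, h₂, h₃, h₄⟩ := ht
    exact .mk (fun w hw => h₁ w (l.vars_reduce_subset hw))
      (fun w hw => h₂ w (h.vars_reduce_subset hw)) (hl h₃) (hh h₄)

/-! ### Flips and the execution tree -/

namespace Expr

theorem flips_pair (e₁ e₂ : Expr) : (pair e₁ e₂).flips = e₁.flips ++ e₂.flips := by
  simp [flips, occ]

theorem flips_flip (i : ℕ) (θ : unitInterval) : (flip i θ).flips = [i] := rfl

theorem flips_letE (x : ℕ) (e₁ e₂ : Expr) : (letE x e₁ e₂).flips = e₁.flips ++ e₂.flips := by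
  simp [flips, occ]

theorem flips_ite (g e₁ e₂ : Expr) :
    (ite g e₁ e₂).flips = g.flips ++ (e₁.flips ++ e₂.flips) := by
  simp [flips, occ]

/-- The execution tree of an expression: the flips in the order of execution, and at the leaves the
returned value together with the success of the executed observations. -/
def tree : (ℕ → Val Bool) → Expr → DTree (Val Bool × Bool)
  | ρ, .var x => .ret (ρ x, true)
  | _, .const b => .ret (.leaf b, true)
  | ρ, .pair e₁ e₂ =>
      (e₁.tree ρ).bind fun r => (e₂.tree ρ).bind fun s => .ret (.pair r.1 s.1, r.2 && s.2)
  | ρ, .fst e => (e.tree ρ).bind fun r => .ret (r.1.fst, r.2)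
  | ρ, .snd e => (e.tree ρ).bind fun r => .ret (r.1.snd, r.2)
  | ρ, .letE x e₁ e₂ =>
      (e₁.tree ρ).bind fun r =>
        (e₂.tree (Function.update ρ x r.1)).bind fun s => .ret (s.1, r.2 && s.2)
  | _, .flip i _ => .node i (.ret (.leaf false, true)) (.ret (.leaf true, true))
  | ρ, .ite g e₁ e₂ =>
      (g.tree ρ).bind fun r =>
        (if r.1.get false = true then e₁.tree ρ else e₂.tree ρ).bind fun s =>
          .ret (s.1, r.2 && s.2)
  | ρ, .observe e => (e.tree ρ).bind fun r => .ret (.leaf true, r.2 && r.1.get false)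

theorem tree_run (ω : ℕ → Bool) (e : Expr) (ρ : ℕ → Val Bool) :
    ((e.tree ρ).eval ω).1 = (e.run ω ρ).1 ∧ (e.tree ρ).path ω = (e.run ω ρ).2 := by
  induction e generalizing ρ with
  | var x => exact ⟨rfl, rfl⟩
  | const b => exact ⟨rfl, rfl⟩
  | flip i θ => cases h : ω i <;> simp [tree, run, DTree.eval, DTree.path, h]
  | pair e₁ e₂ h₁ h₂ =>
    simp [tree, run, DTree.eval_bind, DTree.path_bind, DTree.eval, DTree.path, h₁, h₂]
  | fst e h => simp [tree, run, DTree.eval_bind, DTree.path_bind, DTree.eval, DTree.path, h]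
  | snd e h => simp [tree, run, DTree.eval_bind, DTree.path_bind, DTree.eval, DTree.path, h]
  | observe e h => simp [tree, run, DTree.eval_bind, DTree.path_bind, DTree.eval, DTree.path, h]
  | letE x e₁ e₂ h₁ h₂ =>
    simp [tree, run, DTree.eval_bind, DTree.path_bind, DTree.eval, DTree.path, h₁, h₂]
  | ite g e₁ e₂ hg h₁ h₂ =>
    simp only [tree, run, DTree.eval_bind, DTree.path_bind, DTree.eval, DTree.path, hg]
    split <;> simp [h₁, h₂]

theorem vars_tree_subset {e : Expr} {ρ : ℕ → Val Bool} {w : ℕ} (hw : w ∈ (e.tree ρ).vars) :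
    w ∈ e.flips := by
  induction e generalizing ρ with
  | var x => cases hw
  | const b => cases hw
  | flip i θ => simpa [tree, DTree.vars, flips_flip] using hw
  | pair e₁ e₂ h₁ h₂ =>
    rw [flips_pair, List.mem_append]
    rcases DTree.mem_vars_bind hw with hw | ⟨a, hw⟩
    · exact .inl (h₁ hw)
    rcases DTree.mem_vars_bind hw with hw | ⟨a, hw⟩
    · exact .inr (h₂ hw)
    · cases hw
  | fst e h =>
    rcases DTree.mem_vars_bind hw with hw | ⟨a, hw⟩
    exacts [h hw, by cases hw]
  | snd e h =>
    rcases DTree.mem_vars_bind hw with hw | ⟨a, hw⟩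
    exacts [h hw, by cases hw]
  | observe e h =>
    rcases DTree.mem_vars_bind hw with hw | ⟨a, hw⟩
    exacts [h hw, by cases hw]
  | letE x e₁ e₂ h₁ h₂ =>
    rw [flips_letE, List.mem_append]
    rcases DTree.mem_vars_bind hw with hw | ⟨a, hw⟩
    · exact .inl (h₁ hw)
    rcases DTree.mem_vars_bind hw with hw | ⟨a, hw⟩
    · exact .inr (h₂ hw)
    · cases hw
  | ite g e₁ e₂ hg h₁ h₂ =>
    simp only [flips_ite, List.mem_append]
    rcases DTree.mem_vars_bind hw with hw | ⟨a, hw⟩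
    · exact .inl (hg hw)
    rcases DTree.mem_vars_bind hw with hw | ⟨a, hw⟩
    · split at hw
      exacts [.inr (.inl (h₁ hw)), .inr (.inr (h₂ hw))]
    · cases hw

/-- A run executes each textual occurrence at most once, and different occurrences carry different
identifiers. -/
theorem ordered_tree {e : Expr} (he : e.flips.Nodup) (ρ : ℕ → Val Bool) :
    (e.tree ρ).Ordered (· ≠ ·) := by
  induction e generalizing ρ with
  | var x => trivial
  | const b => trivial
  | flip i θ => simp [tree, DTree.Ordered, DTree.vars]
  | pair e₁ e₂ h₁ h₂ =>
    rw [flips_pair, List.nodup_append] at he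
    refine (h₁ he.1 ρ).bind (fun a => (h₂ he.2.1 ρ).bind (fun _ => trivial) ?_) ?_
    · intro a v _ w hw
      cases hw
    · intro a v hv w hw
      rcases DTree.mem_vars_bind hw with hw | ⟨a, hw⟩
      exacts [he.2.2 v (vars_tree_subset hv) w (vars_tree_subset hw), by cases hw]
  | fst e h => exact (h he ρ).bind (fun _ => trivial) fun a v _ w hw => by cases hw
  | snd e h => exact (h he ρ).bind (fun _ => trivial) fun a v _ w hw => by cases hw
  | observe e h => exact (h he ρ).bind (fun _ => trivial) fun a v _ w hw => by cases hw
  | letE x e₁ e₂ h₁ h₂ =>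
    rw [flips_letE, List.nodup_append] at he
    refine (h₁ he.1 ρ).bind (fun a => (h₂ he.2.1 _).bind (fun _ => trivial) ?_) ?_
    · intro a v _ w hw
      cases hw
    · intro a v hv w hw
      rcases DTree.mem_vars_bind hw with hw | ⟨a, hw⟩
      exacts [he.2.2 v (vars_tree_subset hv) w (vars_tree_subset hw), by cases hw]
  | ite g e₁ e₂ hg h₁ h₂ =>
    rw [flips_ite, List.nodup_append, List.nodup_append] at he
    obtain ⟨n, ⟨n₁, n₂, -⟩, d⟩ := he
    refine (hg n ρ).bind (fun a => DTree.Ordered.bind ?_ (fun _ => trivial) ?_) ?_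
    · split
      exacts [h₁ n₁ ρ, h₂ n₂ ρ]
    · intro a v _ w hw
      cases hw
    · intro a v hv w hw
      rcases DTree.mem_vars_bind hw with hw | ⟨a, hw⟩
      · refine d v (vars_tree_subset hv) w (List.mem_append.2 ?_)
        split at hw
        exacts [.inl (vars_tree_subset hw), .inr (vars_tree_subset hw)]
      · cases hw

/-! ### Semantics of the compiled formulas -/

/-- The compiled formulas of an expression, evaluated at the assignment `ω`. -/
def sem (ω : ℕ → Bool) : (ℕ → Val Bool) → Expr → Val Bool × Bool
  | ρ, .var x => (ρ x, true)
  | _, .const b => (.leaf b, true)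
  | ρ, .pair e₁ e₂ => (.pair (e₁.sem ω ρ).1 (e₂.sem ω ρ).1, (e₁.sem ω ρ).2 && (e₂.sem ω ρ).2)
  | ρ, .fst e => ((e.sem ω ρ).1.fst, (e.sem ω ρ).2)
  | ρ, .snd e => ((e.sem ω ρ).1.snd, (e.sem ω ρ).2)
  | ρ, .letE x e₁ e₂ =>
      ((e₂.sem ω (Function.update ρ x (e₁.sem ω ρ).1)).1,
        (e₁.sem ω ρ).2 && (e₂.sem ω (Function.update ρ x (e₁.sem ω ρ).1)).2)
  | _, .flip i _ => (.leaf (ω i), true)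
  | ρ, .ite g e₁ e₂ =>
      (Val.zipWith false (fun a b => if (g.sem ω ρ).1.get false = true then a else b)
          (e₁.sem ω ρ).1 (e₂.sem ω ρ).1,
        (g.sem ω ρ).2 &&
          if (g.sem ω ρ).1.get false = true then (e₁.sem ω ρ).2 else (e₂.sem ω ρ).2)
  | ρ, .observe e => (.leaf true, (e.sem ω ρ).2 && (e.sem ω ρ).1.get false)

end Expr

/-! ### Tuples: mapping, typing and selection -/

namespace Val

variable {α β : Type}

/-- Applies a function to the entries of a tuple. -/
def map (f : α → β) : Val α → Val β
  | .leaf a => .leaf (f a)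
  | .pair v w => .pair (v.map f) (w.map f)

theorem fst_map (f : α → β) (v : Val α) : (v.map f).fst = v.fst.map f := by cases v <;> rfl

theorem snd_map (f : α → β) (v : Val α) : (v.map f).snd = v.snd.map f := by cases v <;> rfl

theorem get_map (f : α → β) (d : α) (v : Val α) : (v.map f).get (f d) = f (v.get d) := by
  cases v <;> rfl

theorem leaves_map (f : α → β) (v : Val α) : (v.map f).leaves = v.leaves.map f := by
  induction v with
  | leaf a => rfl
  | pair v w hv hw => simp [map, leaves, hv, hw]

theorem map_zipWith (f : α → β) (d : α) (p : α → α → α) (q : β → β → β)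
    (h : ∀ a b, f (p a b) = q (f a) (f b)) (v w : Val α) :
    (zipWith d p v w).map f = zipWith (f d) q (v.map f) (w.map f) := by
  induction v generalizing w with
  | leaf a => cases w <;> simp [map, zipWith, h]
  | pair v₁ v₂ h₁ h₂ => cases w <;> simp [map, zipWith, h₁, h₂]

/-- The value has the given type. -/
def HasTy : Val α → Ty → Prop
  | .leaf _, .bool => True
  | .pair v w, .prod τ₁ τ₂ => v.HasTy τ₁ ∧ w.HasTy τ₂
  | _, _ => False

theorem HasTy.fst {v : Val α} {τ₁ τ₂ : Ty} (h : v.HasTy (.prod τ₁ τ₂)) : v.fst.HasTy τ₁ := by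
  cases v with
  | leaf a => exact h.elim
  | pair v w => exact h.1

theorem HasTy.snd {v : Val α} {τ₁ τ₂ : Ty} (h : v.HasTy (.prod τ₁ τ₂)) : v.snd.HasTy τ₂ := by
  cases v with
  | leaf a => exact h.elim
  | pair v w => exact h.2

/-- Typing enters here. Two values of one type have the same shape, so choosing entry by entry is
choosing the whole value; on different shapes `zipWith` would fall back to the default. -/
theorem zipWith_select (d : α) (c : Bool) {τ : Ty} {v w : Val α} (hv : v.HasTy τ)
    (hw : w.HasTy τ) :
    zipWith d (fun a b => if c = true then a else b) v w = if c = true then v else w := by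
  induction v generalizing w τ with
  | leaf a =>
    cases τ with
    | prod _ _ => exact hv.elim
    | bool =>
      cases w with
      | pair _ _ => exact hw.elim
      | leaf b => cases c <;> rfl
  | pair v₁ v₂ h₁ h₂ =>
    cases τ with
    | bool => exact hv.elim
    | prod τ₁ τ₂ =>
      cases w with
      | leaf b => exact hw.elim
      | pair w₁ w₂ =>
        simp only [zipWith, h₁ hv.1 hw.1, h₂ hv.2 hw.2]
        cases c <;> rfl

end Val

namespace Expr

theorem eval_compile (ω : ℕ → Bool) (e : Expr) (ρ : ℕ → Val Formula) :
    ((e.compile ρ).1.map (Formula.eval ω), (e.compile ρ).2.eval ω) =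
      e.sem ω fun x => (ρ x).map (Formula.eval ω) := by
  -- The symbolic default `.const false` evaluates to the Boolean default `false`, so no typing is
  -- needed for this lemma.
  have hget : ∀ v : Val Formula, (v.map (Formula.eval ω)).get false =
      (v.get (.const false)).eval ω := Val.get_map (Formula.eval ω) (.const false)
  have hupd : ∀ (ρ : ℕ → Val Formula) (x : ℕ) (v : Val Formula),
      (fun y => (Function.update ρ x v y).map (Formula.eval ω)) =
        Function.update (fun y => (ρ y).map (Formula.eval ω)) x (v.map (Formula.eval ω)) := by
    intro ρ x v
    funext y
    by_cases h : y = x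
    · subst h; simp
    · simp [h]
  induction e generalizing ρ with
  | var x => rfl
  | const b => rfl
  | flip i θ => rfl
  | pair e₁ e₂ h₁ h₂ => simp [compile, sem, ← h₁, ← h₂, Val.map, Formula.eval]
  | fst e h => simp [compile, sem, ← h, Val.fst_map]
  | snd e h => simp [compile, sem, ← h, Val.snd_map]
  | observe e h => simp [compile, sem, ← h, Val.map, Formula.eval, hget]
  | letE x e₁ e₂ h₁ h₂ => simp [compile, sem, ← h₁, ← h₂, Formula.eval, ← hupd]
  | ite g e₁ e₂ hg h₁ h₂ =>
    simp only [compile, sem, ← hg, ← h₁, ← h₂, Formula.eval, hget, Prod.mk.injEq, and_true]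
    exact Val.map_zipWith (Formula.eval ω) (.const false) _ _ (fun _ _ => rfl) _ _

theorem hasTy_sem (ω : ℕ → Bool) {Γ : ℕ → Option Ty} {e : Expr} {τ : Ty} (he : HasType Γ e τ)
    {ρ : ℕ → Val Bool} (hρ : ∀ x τ, Γ x = some τ → (ρ x).HasTy τ) : (e.sem ω ρ).1.HasTy τ := by
  induction he generalizing ρ with
  | var h => exact hρ _ _ h
  | const b => trivial
  | flip i θ => trivial
  | pair _ _ h₁ h₂ => exact ⟨h₁ hρ, h₂ hρ⟩
  | fst _ h => exact (h hρ).fst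
  | snd _ h => exact (h hρ).snd
  | observe _ _ => trivial
  | @letE Γ x e₁ e₂ τ₁ τ₂ _ _ h₁ h₂ =>
    refine h₂ fun y τ hy => ?_
    by_cases h : y = x
    · subst h
      simp only [Function.update_self, Option.some.injEq] at hy ⊢
      exact hy ▸ h₁ hρ
    · simp only [Function.update_of_ne h] at hy ⊢
      exact hρ y τ hy
  | ite _ _ _ _ h₁ h₂ =>
    simp only [sem, Val.zipWith_select _ _ (h₁ hρ) (h₂ hρ)]
    split
    exacts [h₁ hρ, h₂ hρ]

/-- Compilation evaluates both branches of a conditional and combines them, whereas execution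
follows one; well-typedness makes the two agree. -/
theorem eval_tree (ω : ℕ → Bool) {Γ : ℕ → Option Ty} {e : Expr} {τ : Ty} (he : HasType Γ e τ)
    {ρ : ℕ → Val Bool} (hρ : ∀ x τ, Γ x = some τ → (ρ x).HasTy τ) :
    (e.tree ρ).eval ω = e.sem ω ρ := by
  induction he generalizing ρ with
  | var h => rfl
  | const b => rfl
  | flip i θ => cases h : ω i <;> simp [tree, sem, DTree.eval, h]
  | pair _ _ h₁ h₂ => simp only [tree, sem, DTree.eval_bind, DTree.eval, h₁ hρ, h₂ hρ]
  | fst _ h => simp only [tree, sem, DTree.eval_bind, DTree.eval, h hρ]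
  | snd _ h => simp only [tree, sem, DTree.eval_bind, DTree.eval, h hρ]
  | observe _ h => simp only [tree, sem, DTree.eval_bind, DTree.eval, h hρ]
  | @letE Γ x e₁ e₂ τ₁ τ₂ t₁ _ h₁ h₂ =>
    simp only [tree, sem, DTree.eval_bind, DTree.eval, h₁ hρ]
    rw [h₂]
    intro y τ hy
    by_cases h : y = x
    · subst h
      simp only [Function.update_self, Option.some.injEq] at hy ⊢
      exact hy ▸ hasTy_sem ω t₁ hρ
    · simp only [Function.update_of_ne h] at hy ⊢
      exact hρ y τ hy
  | ite _ t₁ t₂ hg h₁ h₂ =>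
    simp only [tree, sem, DTree.eval_bind, DTree.eval, hg hρ,
      Val.zipWith_select _ _ (hasTy_sem ω t₁ hρ) (hasTy_sem ω t₂ hρ)]
    split <;> simp only [h₁ hρ, h₂ hρ]

/-! ### Hoisting -/

theorem sem_congr {ω ω' : ℕ → Bool} {e : Expr} (h : ∀ a ∈ e.flips, ω a = ω' a)
    (ρ : ℕ → Val Bool) : e.sem ω ρ = e.sem ω' ρ := by
  induction e generalizing ρ with
  | var x => rfl
  | const b => rfl
  | flip i θ => simp only [sem, h i (by simp [flips_flip])]
  | pair e₁ e₂ h₁ h₂ =>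
    simp only [flips_pair, List.mem_append] at h
    simp only [sem, h₁ fun a ha => h a (.inl ha), h₂ fun a ha => h a (.inr ha)]
  | fst e ih => simp only [sem, ih h]
  | snd e ih => simp only [sem, ih h]
  | observe e ih => simp only [sem, ih h]
  | letE x e₁ e₂ h₁ h₂ =>
    simp only [flips_letE, List.mem_append] at h
    simp only [sem, h₁ fun a ha => h a (.inl ha), h₂ fun a ha => h a (.inr ha)]
  | ite g e₁ e₂ hg h₁ h₂ =>
    simp only [flips_ite, List.mem_append] at h
    simp only [sem, hg fun a ha => h a (.inl ha), h₁ fun a ha => h a (.inr (.inl ha)),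
      h₂ fun a ha => h a (.inr (.inr ha))]

/-- Since `t` occurs in `e` neither free nor bound, no binder overwrites its value `ω k`, and `e`
itself never reads it. -/
theorem sem_replaceFlips {i j k t : ℕ} {ω : ℕ → Bool} {e : Expr} (ht : t ∉ e.vars)
    {ρ ρ' : ℕ → Val Bool} (hρ : ∀ x, x ≠ t → ρ' x = ρ x) (hk : ρ' t = .leaf (ω k)) :
    (e.replaceFlips i j t).sem ω ρ' = e.sem (fun a => ω (relabel i j k a)) ρ := by
  induction e generalizing ρ ρ' with
  | var x =>
    simp only [replaceFlips, sem]
    rw [hρ x (fun h => ht (by simp [vars, h]))]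
  | const b => rfl
  | flip m θ =>
    by_cases h : m = i ∨ m = j
    · simp only [replaceFlips, if_pos h, sem, hk, relabel]
    · simp only [replaceFlips, if_neg h, sem, relabel]
  | pair e₁ e₂ h₁ h₂ =>
    simp only [vars, List.mem_append, not_or] at ht
    simp only [replaceFlips, sem, h₁ ht.1 hρ hk, h₂ ht.2 hρ hk]
  | fst e ih => simp only [replaceFlips, sem, ih ht hρ hk]
  | snd e ih => simp only [replaceFlips, sem, ih ht hρ hk]
  | observe e ih => simp only [replaceFlips, sem, ih ht hρ hk]
  | letE x e₁ e₂ h₁ h₂ =>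
    simp only [vars, List.mem_cons, List.mem_append, not_or] at ht
    simp only [replaceFlips, sem, h₁ ht.2.1 hρ hk]
    rw [h₂ ht.2.2 (ρ := Function.update ρ x (e₁.sem (fun a => ω (relabel i j k a)) ρ).1)]
    · intro y hy
      by_cases h : y = x
      · subst h; simp
      · simp [h, hρ y hy]
    · rw [Function.update_of_ne ht.1, hk]
  | ite g e₁ e₂ hg h₁ h₂ =>
    simp only [vars, List.mem_append, not_or] at ht
    simp only [replaceFlips, sem, hg ht.1 hρ hk, h₁ ht.2.1 hρ hk, h₂ ht.2.2 hρ hk]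

theorem flips_replaceFlips (i j t : ℕ) (e : Expr) :
    (e.replaceFlips i j t).flips = e.flips.filter fun a => ¬(a = i ∨ a = j) := by
  induction e with
  | var x => rfl
  | const b => rfl
  | flip m θ =>
    by_cases h : m = i ∨ m = j
    · simp only [replaceFlips, if_pos h, flips_flip]
      rw [List.filter_cons_of_neg (by simp only [h]; simp)]
      rfl
    · simp only [replaceFlips, if_neg h, flips_flip]
      rw [List.filter_cons_of_pos (by simp only [h]; simp)]
      rfl
  | pair e₁ e₂ h₁ h₂ => simp only [replaceFlips, flips_pair, h₁, h₂, List.filter_append]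
  | fst e ih => exact ih
  | snd e ih => exact ih
  | observe e ih => exact ih
  | letE x e₁ e₂ h₁ h₂ => simp only [replaceFlips, flips_letE, h₁, h₂, List.filter_append]
  | ite g e₁ e₂ hg h₁ h₂ =>
    simp only [replaceFlips, flips_ite, hg, h₁, h₂, List.filter_append]

end Expr

/-! ### The effect of one hoisting step -/

namespace HoistStep

open Dice.Expr

variable {i j k : ℕ} {P Q : Expr}

theorem mem_flips (h : HoistStep i j k P Q) : i ∈ P.flips ∧ j ∈ P.flips := by
  induction h with
  | here t θ e ht hi hj =>
    exact ⟨List.mem_map.2 ⟨_, hi, rfl⟩, List.mem_map.2 ⟨_, hj, rfl⟩⟩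
  | fst _ ih => exact ih
  | snd _ ih => exact ih
  | observe _ ih => exact ih
  | pairL | pairR => simp_all [flips_pair]
  | letL | letR => simp_all [flips_letE]
  | guard | thenB | elseB => simp_all [flips_ite]

/-- Every occurrence of a flip outside the rewritten subexpression is fixed by the relabelling. -/
theorem relabel_eq_self {l m : List ℕ} (hc : (∀ a ∈ l, ∀ b ∈ m, a ≠ b) ∨ i = k ∧ j = k)
    (hl : i ∈ l ∧ j ∈ l) {a : ℕ} (ha : a ∈ m) : relabel i j k a = a := by
  unfold relabel
  split_ifs with h
  · rcases hc with hc | ⟨rfl, rfl⟩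
    · rcases h with rfl | rfl
      exacts [absurd rfl (hc _ hl.1 _ ha), absurd rfl (hc _ hl.2 _ ha)]
    · exact (h.elim id id).symm
  · rfl

/-- The rewriting is local while the relabelling acts on all of `P`. They agree because `i` and `j`
do not occur outside the rewritten subexpression, or because the relabelling is the identity, as in
a move of a single flip. -/
theorem sem_eq (h : HoistStep i j k P Q) (hc : P.flips.Nodup ∨ i = k ∧ j = k) (ω : ℕ → Bool)
    (ρ : ℕ → Val Bool) :
    Q.sem ω ρ = P.sem (fun a => ω (relabel i j k a)) ρ := by
  have out : ∀ (e e' : Expr), ((∀ a ∈ e.flips, ∀ b ∈ e'.flips, a ≠ b) ∨ i = k ∧ j = k) →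
      (i ∈ e.flips ∧ j ∈ e.flips) → ∀ ρ : ℕ → Val Bool,
      e'.sem (fun a => ω (relabel i j k a)) ρ = e'.sem ω ρ := fun e e' h₁ h₂ ρ =>
    sem_congr (fun a ha => by rw [relabel_eq_self h₁ h₂ ha]) ρ
  induction h generalizing ρ with
  | here t θ e ht hi hj =>
    simp only [sem, Bool.true_and, Prod.mk.eta]
    exact sem_replaceFlips ht (fun x hx => Function.update_of_ne hx _ _) (by simp)
  | fst _ ih => simp only [sem, ih hc]
  | snd _ ih => simp only [sem, ih hc]
  | observe _ ih => simp only [sem, ih hc]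
  | @pairL e₁ e₁' e₂ h ih =>
    simp only [flips_pair, List.nodup_append] at hc
    simp only [sem, ih (hc.imp_left (·.1)),
      out e₁ e₂ (hc.imp_left (·.2.2)) h.mem_flips]
  | @pairR e₁ e₂ e₂' h ih =>
    simp only [flips_pair, List.nodup_append] at hc
    simp only [sem, ih (hc.imp_left (·.2.1)),
      out e₂ e₁ (hc.imp_left fun h a ha b hb => (h.2.2 b hb a ha).symm) h.mem_flips]
  | @letL x e₁ e₁' e₂ h ih =>
    simp only [flips_letE, List.nodup_append] at hc
    simp only [sem, ih (hc.imp_left (·.1)),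
      out e₁ e₂ (hc.imp_left (·.2.2)) h.mem_flips]
  | @letR x e₁ e₂ e₂' h ih =>
    simp only [flips_letE, List.nodup_append] at hc
    simp only [sem, ih (hc.imp_left (·.2.1)),
      out e₂ e₁ (hc.imp_left fun h a ha b hb => (h.2.2 b hb a ha).symm) h.mem_flips]
  | @guard g g' e₁ e₂ h ih =>
    simp only [flips_ite, List.nodup_append, List.mem_append] at hc
    simp only [sem, ih (hc.imp_left (·.1)),
      out g e₁ (hc.imp_left fun h a ha b hb => h.2.2 a ha b (.inl hb)) h.mem_flips,
      out g e₂ (hc.imp_left fun h a ha b hb => h.2.2 a ha b (.inr hb)) h.mem_flips]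
  | @thenB g e₁ e₁' e₂ h ih =>
    simp only [flips_ite, List.nodup_append, List.mem_append] at hc
    simp only [sem, ih (hc.imp_left (·.2.1.1)),
      out e₁ g (hc.imp_left fun h a ha b hb => (h.2.2 b hb a (.inl ha)).symm) h.mem_flips,
      out e₁ e₂ (hc.imp_left fun h => h.2.1.2.2) h.mem_flips]
  | @elseB g e₁ e₂ e₂' h ih =>
    simp only [flips_ite, List.nodup_append, List.mem_append] at hc
    simp only [sem, ih (hc.imp_left (·.2.1.2.1)),
      out e₂ g (hc.imp_left fun h a ha b hb => (h.2.2 b hb a (.inr ha)).symm) h.mem_flips,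
      out e₂ e₁ (hc.imp_left fun h a ha b hb => (h.2.1.2.2 b hb a ha).symm) h.mem_flips]

theorem relabel_mem_flips (h : HoistStep i j k P Q) (hc : P.flips.Nodup ∨ i = k ∧ j = k) {a : ℕ}
    (ha : a ∈ P.flips) : relabel i j k a ∈ Q.flips := by
  induction h with
  | here t θ e ht hi hj =>
    simp only [flips_letE, flips_flip, flips_replaceFlips, relabel]
    split_ifs with h <;> simp_all
  | fst _ ih => exact ih hc ha
  | snd _ ih => exact ih hc ha
  | observe _ ih => exact ih hc ha
  | @pairL e₁ e₁' e₂ h ih =>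
    simp only [flips_pair, List.nodup_append, List.mem_append] at hc ha ⊢
    refine ha.imp (ih (hc.imp_left (·.1))) fun ha => ?_
    rwa [relabel_eq_self (hc.imp_left (·.2.2)) h.mem_flips ha]
  | @pairR e₁ e₂ e₂' h ih =>
    simp only [flips_pair, List.nodup_append, List.mem_append] at hc ha ⊢
    refine ha.imp (fun ha => ?_) (ih (hc.imp_left (·.2.1)))
    rwa [relabel_eq_self (hc.imp_left fun h a ha b hb => (h.2.2 b hb a ha).symm) h.mem_flips ha]
  | @letL x e₁ e₁' e₂ h ih =>
    simp only [flips_letE, List.nodup_append, List.mem_append] at hc ha ⊢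
    refine ha.imp (ih (hc.imp_left (·.1))) fun ha => ?_
    rwa [relabel_eq_self (hc.imp_left (·.2.2)) h.mem_flips ha]
  | @letR x e₁ e₂ e₂' h ih =>
    simp only [flips_letE, List.nodup_append, List.mem_append] at hc ha ⊢
    refine ha.imp (fun ha => ?_) (ih (hc.imp_left (·.2.1)))
    rwa [relabel_eq_self (hc.imp_left fun h a ha b hb => (h.2.2 b hb a ha).symm) h.mem_flips ha]
  | @guard g g' e₁ e₂ h ih =>
    simp only [flips_ite, List.nodup_append, List.mem_append] at hc ha ⊢
    refine ha.imp (ih (hc.imp_left (·.1))) fun ha => ?_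
    rwa [relabel_eq_self (m := e₁.flips ++ e₂.flips)
      (hc.imp_left fun h a ha b hb => h.2.2 a ha b (List.mem_append.1 hb)) h.mem_flips
      (List.mem_append.2 ha)]
  | @thenB g e₁ e₁' e₂ h ih =>
    simp only [flips_ite, List.nodup_append, List.mem_append] at hc ha ⊢
    refine ha.imp (fun ha => ?_) (Or.imp (ih (hc.imp_left (·.2.1.1))) fun ha => ?_)
    · rwa [relabel_eq_self (hc.imp_left fun h a ha b hb => (h.2.2 b hb a (.inl ha)).symm)
        h.mem_flips ha]
    · rwa [relabel_eq_self (hc.imp_left fun h => h.2.1.2.2) h.mem_flips ha]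
  | @elseB g e₁ e₂ e₂' h ih =>
    simp only [flips_ite, List.nodup_append, List.mem_append] at hc ha ⊢
    refine ha.imp (fun ha => ?_) (Or.imp (fun ha => ?_) (ih (hc.imp_left (·.2.1.2.1))))
    · rwa [relabel_eq_self (hc.imp_left fun h a ha b hb => (h.2.2 b hb a (.inr ha)).symm)
        h.mem_flips ha]
    · rwa [relabel_eq_self (hc.imp_left fun h a ha b hb => (h.2.1.2.2 b hb a ha).symm)
        h.mem_flips ha]

/-- With distinct identifiers, a move deletes exactly one occurrence of `m` and inserts one.
Distinctness thus survives the moves made before the actual hoisting, which needs it. -/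
theorem flips_perm {m : ℕ} (h : HoistStep m m m P Q) (hP : P.flips.Nodup) :
    Q.flips.Perm P.flips := by
  induction h with
  | here t θ e ht hi hj =>
    have hm : m ∈ e.flips := List.mem_map.2 ⟨_, hi, rfl⟩
    rw [flips_letE, flips_flip, flips_replaceFlips]
    refine (List.perm_ext_iff_of_nodup ?_ hP).2 fun a => ?_
    · exact List.nodup_cons.2 ⟨by simp, hP.filter _⟩
    · by_cases h : a = m
      · subst h; simp [hm]
      · simp [h]
  | fst _ ih => exact ih hP
  | snd _ ih => exact ih hP
  | observe _ ih => exact ih hP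
  | pairL e₂ h ih =>
    simp only [flips_pair, List.nodup_append] at hP ⊢
    exact (ih hP.1).append_right _
  | pairR e₁ h ih =>
    simp only [flips_pair, List.nodup_append] at hP ⊢
    exact (ih hP.2.1).append_left _
  | letL x e₂ h ih =>
    simp only [flips_letE, List.nodup_append] at hP ⊢
    exact (ih hP.1).append_right _
  | letR x e₁ h ih =>
    simp only [flips_letE, List.nodup_append] at hP ⊢
    exact (ih hP.2.1).append_left _
  | guard e₁ e₂ h ih =>
    simp only [flips_ite, List.nodup_append] at hP ⊢
    exact (ih hP.1).append_right _
  | thenB g e₂ h ih =>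
    simp only [flips_ite, List.nodup_append] at hP ⊢
    exact ((ih hP.2.1.1).append_right _).append_left _
  | elseB g e₁ h ih =>
    simp only [flips_ite, List.nodup_append] at hP ⊢
    exact ((ih hP.2.1.2.1).append_left _).append_left _

end HoistStep

/-! ### Chains of hoisting steps -/

theorem relabel_self (m : ℕ) : relabel m m m = id := by
  funext a
  by_cases h : a = m <;> simp [relabel, h]

theorem sem_eq_of_moves {P Q : Expr} (h : Relation.ReflTransGen MoveStep P Q) (ω : ℕ → Bool)
    (ρ : ℕ → Val Bool) : Q.sem ω ρ = P.sem ω ρ := by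
  induction h with
  | refl => rfl
  | tail _ h ih =>
    obtain ⟨m, h⟩ := h
    rw [h.sem_eq (.inr ⟨rfl, rfl⟩), relabel_self, ← ih]
    rfl

theorem flips_subset_of_moves {P Q : Expr} (h : Relation.ReflTransGen MoveStep P Q) {a : ℕ}
    (ha : a ∈ P.flips) : a ∈ Q.flips := by
  induction h with
  | refl => exact ha
  | tail _ h ih =>
    obtain ⟨m, h⟩ := h
    simpa [relabel_self] using h.relabel_mem_flips (.inr ⟨rfl, rfl⟩) ih

theorem nodup_flips_of_moves {P Q : Expr} (h : Relation.ReflTransGen MoveStep P Q)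
    (hP : P.flips.Nodup) : Q.flips.Nodup := by
  induction h with
  | refl => exact hP
  | tail _ h ih =>
    obtain ⟨m, h⟩ := h
    exact (h.flips_perm ih).nodup_iff.2 ih

theorem IsHoist.sem_eq {i j k : ℕ} {P Q : Expr} (h : IsHoist i j k P Q) (hP : P.flips.Nodup)
    (ω : ℕ → Bool) (ρ : ℕ → Val Bool) : Q.sem ω ρ = P.sem (fun a => ω (relabel i j k a)) ρ := by
  obtain ⟨-, R, S, hR, hS, hQ⟩ := h
  rw [sem_eq_of_moves hQ, hS.sem_eq (.inl (nodup_flips_of_moves hR hP)), sem_eq_of_moves hR]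

theorem IsHoist.relabel_mem_flips {i j k : ℕ} {P Q : Expr} (h : IsHoist i j k P Q)
    (hP : P.flips.Nodup) {a : ℕ} (ha : a ∈ P.flips) : relabel i j k a ∈ Q.flips := by
  obtain ⟨-, R, S, hR, hS, hQ⟩ := h
  exact flips_subset_of_moves hQ
    (hS.relabel_mem_flips (.inl (nodup_flips_of_moves hR hP)) (flips_subset_of_moves hR ha))

/-! ### The compiled diagrams -/

/-- The entries of a tuple followed by the acceptance bit. -/
def outputs (r : Val Bool × Bool) : List Bool := r.1.leaves ++ [r.2]

theorem map_eval_compiledFormulas (P : Expr) (ω : ℕ → Bool) :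
    (compiledFormulas P).map (Formula.eval ω) =
      outputs (P.sem ω fun _ => .leaf false) := by
  have h := Expr.eval_compile ω P fun _ => .leaf (.const false)
  simp only [Val.map, Formula.eval] at h
  rw [← h]
  simp [compiledFormulas, outputs, Val.leaves_map]

theorem IsHoist.exists_formula {i j k : ℕ} {P Q : Expr} (h : IsHoist i j k P Q)
    (hP : P.flips.Nodup) {G : Formula} (hG : G ∈ compiledFormulas Q) :
    ∃ F ∈ compiledFormulas P, ∀ ω, G.eval ω = F.eval fun a => ω (relabel i j k a) := by
  have key : ∀ ω, (compiledFormulas Q).map (Formula.eval ω) =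
      (compiledFormulas P).map (Formula.eval fun a => ω (relabel i j k a)) := fun ω => by
    rw [map_eval_compiledFormulas, map_eval_compiledFormulas, h.sem_eq hP]
  obtain ⟨n, hn, rfl⟩ := List.getElem_of_mem hG
  -- The formulas are matched by position; any one assignment shows that the two lists are equally
  -- long.
  have hlen : (compiledFormulas Q).length = (compiledFormulas P).length := by
    simpa using congrArg List.length (key fun _ => false)
  refine ⟨(compiledFormulas P)[n]'(hlen ▸ hn), List.getElem_mem _, fun ω => ?_⟩
  have := congrArg (fun l => l[n]?) (key ω)
  simpa [hn, hlen ▸ hn] using this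

/-- Every compiled formula of a program is represented by a reduced diagram in which flips are
tested in program order. -/
theorem exists_diagram {P : Expr} (hP : IsProgram P) {F : Formula}
    (hF : F ∈ compiledFormulas P) :
    ∃ D : BDD, D.Ordered (Precedes P) ∧ (∀ w ∈ D.vars, w ∈ P.flips) ∧
      ∀ ω, F.eval ω = D.eval ω := by
  obtain ⟨⟨τ, hτ⟩, hnd⟩ := hP
  obtain ⟨n, hn, rfl⟩ := List.getElem_of_mem hF
  -- The tree of the `n`-th output bit. The default `false` is not used at a leaf reached by an
  -- assignment, where there are as many outputs as compiled formulas.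
  set T := (P.tree fun _ => .leaf false).map fun r => (outputs r)[n]?.getD false with hT
  have hord : T.Ordered (Precedes P) := by
    refine ((Expr.ordered_tree hnd _).map _).of_path fun ω a b hab => ⟨ω, ?_⟩
    rwa [DTree.path_map, (Expr.tree_run ω P _).2] at hab
  refine ⟨T.reduce, hord.reduce, fun w hw => ?_, fun ω => ?_⟩
  · have := T.vars_reduce_subset hw
    rw [hT, DTree.vars_map] at this
    exact Expr.vars_tree_subset this
  · rw [DTree.eval_reduce, hT, DTree.eval_map, Expr.eval_tree ω hτ (by simp),
      ← map_eval_compiledFormulas]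
    simp [hn]

/-- Canonicity is used twice: for `o`, to replace the diagram of `P` by one ordered by program
order, and for `o'`, to recognise its merge as the diagram of `Q`. -/
theorem robdd_hoist {P Q : Expr} {i j k : ℕ} {o o' : List ℕ} (hP : IsProgram P)
    (hQ : IsHoist i j k P Q) (ho : IsVarOrder P o) (ho' : o'.Perm Q.flips)
    (hpres : PreservesOrder i j k P o') {F G : Formula} (hF : F ∈ compiledFormulas P)
    (hFG : ∀ ω, G.eval ω = F.eval fun a => ω (relabel i j k a)) :
    robdd o' (fun ω => G.eval ω) = (robdd o fun ω => F.eval ω).merge i j k := by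
  obtain ⟨D, hD, hv, he⟩ := exists_diagram hP hF
  have hDo : robdd o (fun ω => F.eval ω) = D :=
    robdd_eq (hD.mono fun a _ b _ => ho.2 a b) (fun w hw => ho.1.mem_iff.2 (hv w hw)) he
  rw [hDo]
  refine robdd_eq (BDD.Ordered.merge (hD.mono fun a ha b hb hab => ?_)) (fun w hw => ?_)
    fun ω => by rw [hFG, he, BDD.eval_merge]
  · refine (hpres a b hab).imp_left fun h => ?_
    -- Distinct flips with the same relabelling include one of `i`, `j`. It may be taken to be the
    -- upper one, `a`: otherwise `a` would be `k`, and an identifier `k` already present in `P` is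
    -- that of `i` or `j`.
    have hne : a ≠ b := fun e => lt_irrefl _ (e ▸ ho.2 a b hab)
    have ha' := hQ.1 a (hv a ha)
    have hb' := hQ.1 b (hv b hb)
    unfold relabel at h ⊢
    split_ifs at h ⊢ <;> grind
  · obtain ⟨a, ha, rfl⟩ := BDD.exists_of_mem_vars_merge hw
    exact ho'.mem_iff.2 (hQ.relabel_mem_flips hP.2 (hv a ha))

end Dice

theorem mainTheorem3 (P Q : Dice.Expr) (i j k : ℕ) (o o' : List ℕ)
    (hP : Dice.IsProgram P)
    (hQ : Dice.IsHoist i j k P Q)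
    (ho : Dice.IsVarOrder P o)
    (ho' : Dice.IsVarOrder Q o')
    (hpres : Dice.PreservesOrder i j k P o') :
    Dice.bddSize o' Q ≤ Dice.bddSize o P := by
  -- The nodes of `Q` are compared with the image under `merge` of all nodes of `P` at once, so
  -- nodes shared by several roots are counted once on both sides.
  refine le_trans (Finset.card_le_card ?_)
    (Finset.card_image_le (f := Dice.BDD.merge i j k)
      (s := (Dice.bddRoots o P).biUnion Dice.BDD.nodes))
  intro x hx
  simp only [Finset.mem_biUnion, Dice.bddRoots, List.mem_toFinset, List.mem_map] at hx
  obtain ⟨_, ⟨G, hG, rfl⟩, hx⟩ := hx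
  obtain ⟨F, hF, hFG⟩ := hQ.exists_formula hP.2 hG
  rw [Dice.robdd_hoist hP hQ ho ho'.1 hpres hF hFG] at hx
  obtain ⟨y, hy, rfl⟩ := Finset.mem_image.1 (Dice.BDD.nodes_merge_subset i j k _ hx)
  refine Finset.mem_image_of_mem _ (Finset.mem_biUnion.2 ⟨_, ?_, hy⟩)
  exact List.mem_toFinset.2 (List.mem_map.2 ⟨F, hF, rfl⟩)
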